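/- A symmetric $d$-class association scheme on a finite set $X$ is a partition of $X\times X$ into nonempty symmetric relations $R_0=\{(x,x)\mid x\in X\},R_1,\dots,R_d$ for which there are numbers $p^h_{ij}$ ($0\le h,i,j\le d$), called its intersection numbers, such that for every $(x,y)\in R_h$ there are precisely $p^h_{ij}$ elements $z\in X$ with $(x,z)\in R_i$ and $(z,y)\in R_j$. **Theorem.** There is no symmetric $5$-class association scheme with intersection numbers $$ \begin{aligned} (p^0_{ij})_{i,j=0}^5 &= \begin{pmatrix} 1&0&0&0&0&0\\ 0&6&0&0&0&0\\ 0&0&18&0&0&0\\ 0&0&0&2&0&0\\ 0&0&0&0&6&0\\ 0&0&0&0&0&12 \end{pmatrix}, & (p^1_{ij})_{i,j=0}^5 &= \begin{pmatrix} 0&1&0&0&0&0\\ 1&0&3&0&2&0\\ 0&3&9&0&0&6\\ 0&0&0&0&0&2\\ 0&2&0&0&0&4\\ 0&0&6&2&4&0 \end{pmatrix},\\ (p^2_{ij})_{i,j=0}^5 &= \begin{pmatrix} 0&0&1&0&0&0\\ 0&1&3&0&0&2\\ 1&3&0&2&6&6\\ 0&0&2&0&0&0\\ 0&0&6&0&0&0\\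 0&2&6&0&0&4 \end{pmatrix}, & (p^3_{ij})_{i,j=0}^5 &= \begin{pmatrix} 0&0&0&1&0&0\\ 0&0&0&0&0&6\\ 0&0&18&0&0&0\\ 1&0&0&1&0&0\\ 0&0&0&0&6&0\\ 0&6&0&0&0&6 \end{pmatrix},\\ (p^4_{ij})_{i,j=0}^5 &= \begin{pmatrix} 0&0&0&0&1&0\\ 0&2&0&0&0&4\\ 0&0&18&0&0&0\\ 0&0&0&0&2&0\\ 1&0&0&2&3&0\\ 0&4&0&0&0&8 \end{pmatrix}, & (p^5_{ij})_{i,j=0}^5 &= \begin{pmatrix} 0&0&0&0&0&1\\ 0&0&3&1&2&0\\ 0&3&9&0&0&6\\ 0&1&0&0&0&1\\ 0&2&0&0&0&4\\ 1&0&6&1&4&0 \end{pmatrix}. \end{aligned} $$ (Such a scheme would necessarily have $1+6+18+2+6+12=45$ vertices.) -/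

import Mathlib

/-- A symmetric `d`-class relation scheme on `X`: the relations `R 0, …, R d` are nonempty and
symmetric, they partition `X × X`, and `R 0` is the identity relation. -/
structure SymmetricRelationScheme (X : Type*) (d : ℕ) where
  /-- the relations -/
  R : Fin (d + 1) → X → X → Prop
  /-- each pair of vertices lies in precisely one of the relations -/
  existsUnique_rel : ∀ x y : X, ∃! i : Fin (d + 1), R i x y
  /-- no relation is empty -/
  rel_nonempty : ∀ i : Fin (d + 1), ∃ x y : X, R i x y
  /-- the relation with index `0` is the identity relation -/
  rel_zero_iff : ∀ x y : X, R 0 x y ↔ x = y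
  /-- every relation is symmetric -/
  rel_symm : ∀ (i : Fin (d + 1)) (x y : X), R i x y → R i y x

/-- A symmetric `d`-class association scheme on a finite vertex set `X`, with its intersection
numbers: `p h i j` is the number of `z` with `(x, z) ∈ R i` and `(z, y) ∈ R j`, for every
`(x, y) ∈ R h`. As no relation is empty, the numbers `p h i j` are determined by the relations. -/
structure AssociationScheme (X : Type*) [Finite X] (d : ℕ)
    extends SymmetricRelationScheme X d where
  /-- the intersection numbers, with the upper index first -/
  p : Fin (d + 1) → Fin (d + 1) → Fin (d + 1) → ℕ
  /-- the defining property of the intersection numbers -/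
  ncard_eq : ∀ (h i j : Fin (d + 1)) (x y : X), R h x y →
    {z : X | R i x z ∧ R j z y}.ncard = p h i j

/-- The prescribed intersection numbers (of a `5`-class scheme on `45` vertices): the entry
`(i, j)` of the matrix with index `h` is the value of `p h i j`. -/
def prescribedNumbers : Fin 6 → Matrix (Fin 6) (Fin 6) ℕ :=
  ![!![1, 0, 0, 0, 0, 0;
       0, 6, 0, 0, 0, 0;
       0, 0, 18, 0, 0, 0;
       0, 0, 0, 2, 0, 0;
       0, 0, 0, 0, 6, 0;
       0, 0, 0, 0, 0, 12],
    !![0, 1, 0, 0, 0, 0;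
       1, 0, 3, 0, 2, 0;
       0, 3, 9, 0, 0, 6;
       0, 0, 0, 0, 0, 2;
       0, 2, 0, 0, 0, 4;
       0, 0, 6, 2, 4, 0],
    !![0, 0, 1, 0, 0, 0;
       0, 1, 3, 0, 0, 2;
       1, 3, 0, 2, 6, 6;
       0, 0, 2, 0, 0, 0;
       0, 0, 6, 0, 0, 0;
       0, 2, 6, 0, 0, 4],
    !![0, 0, 0, 1, 0, 0;
       0, 0, 0, 0, 0, 6;
       0, 0, 18, 0, 0, 0;
       1, 0, 0, 1, 0, 0;
       0, 0, 0, 0, 6, 0;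
       0, 6, 0, 0, 0, 6],
    !![0, 0, 0, 0, 1, 0;
       0, 2, 0, 0, 0, 4;
       0, 0, 18, 0, 0, 0;
       0, 0, 0, 0, 2, 0;
       1, 0, 0, 2, 3, 0;
       0, 4, 0, 0, 0, 8],
    !![0, 0, 0, 0, 0, 1;
       0, 0, 3, 1, 2, 0;
       0, 3, 9, 0, 0, 6;
       0, 1, 0, 0, 0, 1;
       0, 2, 0, 0, 0, 4;
       1, 0, 6, 1, 4, 0]]

namespace AssociationScheme

variable {X : Type*} [Finite X] {d : ℕ} (A : AssociationScheme X d)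

/-! Only relations 1, 3 and 4 matter. Vertices that are equal or 3-related have the same
4-neighbours, and with `p 4 3 4 = 2` and `p 4 4 4 = 3` this rules out a 4-clique in relation 4
(`not_four_clique`). On the other hand, `p 2 1 1 = 1`, `p 4 1 1 = 2` and `p 2 4 4 = 0` force
suitable common 1-neighbours to be 4-related, which builds such a clique. -/

theorem rel_unique {i j : Fin (d + 1)} {x y : X} (hi : A.R i x y) (hj : A.R j x y) : i = j :=
  (A.existsUnique_rel x y).unique hi hj

theorem p_ne_zero {h i j : Fin (d + 1)} {x y z : X} (hxy : A.R h x y) (hxz : A.R i x z)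
    (hzy : A.R j z y) : A.p h i j ≠ 0 := by
  rw [← A.ncard_eq h i j x y hxy]
  exact Set.ncard_ne_zero_of_mem (a := z) ⟨hxz, hzy⟩

/-- A finset of common `(i, j)`-neighbours of an `h`-related pair has at most `p h i j` elements. -/
theorem card_le_p {h i j : Fin (d + 1)} {x y : X} (hxy : A.R h x y) (s : Finset X)
    (hs : ∀ z ∈ s, A.R i x z ∧ A.R j z y) : s.card ≤ A.p h i j := by
  rw [← A.ncard_eq h i j x y hxy, ← Set.ncard_coe_finset]
  exact Set.ncard_le_ncard hs (Set.toFinite _)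

theorem exists_pair {h i j : Fin (d + 1)} {x y : X} (hxy : A.R h x y) (hp : A.p h i j = 2) :
    ∃ z w, z ≠ w ∧ (A.R i x z ∧ A.R j z y) ∧ (A.R i x w ∧ A.R j w y) := by
  obtain ⟨z, w, hne, hs⟩ := Set.ncard_eq_two.1 ((A.ncard_eq h i j x y hxy).trans hp)
  have hz : z ∈ ({z, w} : Set X) := by simp
  have hw : w ∈ ({z, w} : Set X) := by simp
  rw [← hs] at hz hw
  exact ⟨z, w, hne, hz, hw⟩

theorem exists_ne {h i j : Fin (d + 1)} {x y : X} (hxy : A.R h x y) (hp : A.p h i j = 2) (t : X) :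
    ∃ z, z ≠ t ∧ A.R i x z ∧ A.R j z y := by
  obtain ⟨z, w, hne, hz, hw⟩ := A.exists_pair hxy hp
  by_cases hzt : z = t
  · exact ⟨w, fun hwt => hne (hzt.trans hwt.symm), hw⟩
  · exact ⟨z, hzt, hz⟩

end AssociationScheme

section Prescribed

variable {X : Type*} [Finite X] {A : AssociationScheme X 5}
  (hA : ∀ h i j : Fin 6, A.p h i j = prescribedNumbers h i j)
include hA

/-- Two vertices with a common `1`-neighbour are equal, `2`-related or `4`-related. -/
theorem rel_of_common_one {x y z : X} (hxz : A.R 1 x z) (hyz : A.R 1 y z) (hne : x ≠ y) :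
    A.R 2 x y ∨ A.R 4 x y := by
  obtain ⟨h, hh, -⟩ := A.existsUnique_rel x y
  have hp := A.p_ne_zero hh hxz (A.rel_symm _ _ _ hyz)
  rw [hA] at hp
  -- `p h 1 1` is nonzero only for `h` equal to 0, 2 or 4.
  fin_cases h
  · exact absurd ((A.rel_zero_iff x y).1 hh) hne
  · exact absurd rfl hp
  · exact Or.inl hh
  · exact absurd rfl hp
  · exact Or.inr hh
  · exact absurd rfl hp

/-- Distinct vertices with a common `1`-neighbour and a common `4`-neighbour are `4`-related. -/
theorem rel_four_of_common_four {x y z t : X} (hxz : A.R 1 x z) (hyz : A.R 1 y z)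
    (hxt : A.R 4 x t) (hyt : A.R 4 y t) (hne : x ≠ y) : A.R 4 x y := by
  refine (rel_of_common_one hA hxz hyz hne).resolve_left fun h => ?_
  -- Relation 2 is excluded by `p 2 4 4 = 0`.
  have hp := A.p_ne_zero h hxt (A.rel_symm _ _ _ hyt)
  rw [hA] at hp
  exact hp rfl

/-- Distinct vertices with two common `1`-neighbours are `4`-related. -/
theorem rel_four_of_two_common_one {x y z w : X} (hxz : A.R 1 x z) (hyz : A.R 1 y z)
    (hxw : A.R 1 x w) (hyw : A.R 1 y w) (hzw : z ≠ w) (hne : x ≠ y) : A.R 4 x y := by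
  classical
  refine (rel_of_common_one hA hxz hyz hne).resolve_left fun h => ?_
  have hc := A.card_le_p (i := 1) (j := 1) h {z, w} (by
    simp only [Finset.mem_insert, Finset.mem_singleton]
    rintro t (rfl | rfl)
    exacts [⟨hxz, A.rel_symm _ _ _ hyz⟩, ⟨hxw, A.rel_symm _ _ _ hyw⟩])
  rw [hA, Finset.card_pair hzw] at hc
  exact absurd hc (by decide)

/-- Distinct vertices have at most two common `1`-neighbours. -/
theorem not_three_common_one {x y z w u : X} (hne : x ≠ y) (hzw : z ≠ w) (hzu : z ≠ u)
    (hwu : w ≠ u) (hxz : A.R 1 x z) (hyz : A.R 1 y z) (hxw : A.R 1 x w) (hyw : A.R 1 y w)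
    (hxu : A.R 1 x u) (hyu : A.R 1 y u) : False := by
  classical
  have h4 := rel_four_of_two_common_one hA hxz hyz hxw hyw hzw hne
  have hc := A.card_le_p (i := 1) (j := 1) h4 {z, w, u} (by
    simp only [Finset.mem_insert, Finset.mem_singleton]
    rintro t (rfl | rfl | rfl)
    exacts [⟨hxz, A.rel_symm _ _ _ hyz⟩, ⟨hxw, A.rel_symm _ _ _ hyw⟩,
      ⟨hxu, A.rel_symm _ _ _ hyu⟩])
  rw [hA, Finset.card_eq_three.2 ⟨z, w, u, hzw, hzu, hwu, rfl⟩] at hc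
  exact absurd hc (by decide)

/-- `p h 3 4` vanishes unless `h = 4`. Hence a 4-neighbour of a vertex is a 4-neighbour of its whole
3-class. -/
theorem rel_four_of_three_four {m x y : X} (hxm : A.R 3 x m) (hxy : A.R 4 x y) :
    A.R 4 m y := by
  obtain ⟨h, hh, -⟩ := A.existsUnique_rel m y
  have hp := A.p_ne_zero hh (A.rel_symm _ _ _ hxm) hxy
  rw [hA] at hp
  fin_cases h
  · exact absurd rfl hp
  · exact absurd rfl hp
  · exact absurd rfl hp
  · exact absurd rfl hp
  · exact hh
  · exact absurd rfl hp

/-- The graph of relation `4` contains no `4`-clique. -/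
theorem not_four_clique {a b x y : X} (hab : A.R 4 a b) (hax : A.R 4 a x) (hay : A.R 4 a y)
    (hbx : A.R 4 b x) (hby : A.R 4 b y) (hxy : A.R 4 x y) : False := by
  classical
  -- `m` and `n` are the other members of the 3-class of `x`. Together with `x` and `y` they give
  -- `a` and `b` four common 4-neighbours, against `p 4 4 4 = 3`.
  obtain ⟨m, n, hmn, ⟨hxm, hma⟩, hxn, hna⟩ :=
    A.exists_pair (A.rel_symm _ _ _ hax) (i := 3) (j := 4) (by rw [hA]; rfl)
  have hne {i : Fin 6} (hi : i ≠ 0) {s t : X} (h : A.R i s t) : s ≠ t := fun hst =>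
    hi (A.rel_unique h ((A.rel_zero_iff s t).2 hst))
  have hy {t : X} (h : A.R 3 x t) : y ≠ t := by
    rintro rfl
    exact absurd (A.rel_unique h hxy) (by decide)
  have hmb := rel_four_of_three_four hA hxm (A.rel_symm _ _ _ hbx)
  have hnb := rel_four_of_three_four hA hxn (A.rel_symm _ _ _ hbx)
  have hc := A.card_le_p (i := 4) (j := 4) hab {x, y, m, n} (by
    simp only [Finset.mem_insert, Finset.mem_singleton]
    rintro t (rfl | rfl | rfl | rfl)
    exacts [⟨hax, A.rel_symm _ _ _ hbx⟩, ⟨hay, A.rel_symm _ _ _ hby⟩,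
      ⟨A.rel_symm _ _ _ hma, hmb⟩, ⟨A.rel_symm _ _ _ hna, hnb⟩])
  have hcard : ({x, y, m, n} : Finset X).card = 4 := by
    rw [Finset.card_insert_of_notMem, Finset.card_insert_of_notMem, Finset.card_pair hmn]
    · simp [hy hxm, hy hxn]
    · simp [hne (by decide) hxy, hne (by decide) hxm, hne (by decide) hxn]
  rw [hA, hcard] at hc
  exact absurd hc (by decide)

end Prescribed

/-- A vertex `p` has three pairwise `4`-related `1`-neighbours `z`, `w`, `u`. Any two of them have
exactly one common `1`-neighbour besides `p`, and these three vertices form a `4`-clique with `p`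
in the graph of relation `4`, which is a union of complete tripartite graphs. -/
theorem mainTheorem3 {X : Type*} [Finite X] :
    ¬ ∃ A : AssociationScheme X 5,
      ∀ h i j : Fin 6, A.p h i j = prescribedNumbers h i j := by
  rintro ⟨A, hA⟩
  obtain ⟨z, p, hzp⟩ := A.rel_nonempty 1
  obtain ⟨w, u, hwu, ⟨hzw, hwp⟩, hzu, hup⟩ :=
    A.exists_pair hzp (i := 4) (j := 1) (by rw [hA]; rfl)
  have symm {i : Fin 6} {x y : X} (h : A.R i x y) : A.R i y x := A.rel_symm i x y h
  have hwu4 : A.R 4 w u := rel_four_of_common_four hA hwp hup (symm hzw) (symm hzu) hwu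
  have hne {x y : X} (h : A.R 4 x y) : x ≠ y := fun hxy =>
    absurd (A.rel_unique h ((A.rel_zero_iff x y).2 hxy)) (by decide)
  have h2 : A.p 4 1 1 = 2 := by rw [hA]; rfl
  obtain ⟨a, hap, hza, haw⟩ := A.exists_ne hzw h2 p
  obtain ⟨b, hbp, hzb, hbu⟩ := A.exists_ne hzu h2 p
  obtain ⟨c, hcp, hwc, hcu⟩ := A.exists_ne hwu4 h2 p
  -- This keeps `a`, `b`, `c` distinct: if two coincided, that vertex would share `z`, `w`, `u` with
  -- `p`.
  have no3 {x : X} (hxp : x ≠ p) (hxz : A.R 1 x z) (hxw : A.R 1 x w) (hxu : A.R 1 x u) : False :=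
    not_three_common_one hA hxp (hne hzw) (hne hzu) hwu hxz (symm hzp) hxw (symm hwp)
      hxu (symm hup)
  have hap4 : A.R 4 a p :=
    rel_four_of_two_common_one hA (symm hza) (symm hzp) haw (symm hwp) (hne hzw) hap
  have hbp4 : A.R 4 b p :=
    rel_four_of_two_common_one hA (symm hzb) (symm hzp) hbu (symm hup) (hne hzu) hbp
  have hcp4 : A.R 4 c p :=
    rel_four_of_two_common_one hA (symm hwc) (symm hwp) hcu (symm hup) hwu hcp
  -- `a` and `b` share the 1-neighbour `z` and the 4-neighbour `p`; the other pairs share `w` or `u`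
  -- instead of `z`.
  have hab : A.R 4 a b := by
    refine rel_four_of_common_four hA (symm hza) (symm hzb) hap4 hbp4 ?_
    rintro rfl
    exact no3 hap (symm hza) haw hbu
  have hac : A.R 4 a c := by
    refine rel_four_of_common_four hA haw (symm hwc) hap4 hcp4 ?_
    rintro rfl
    exact no3 hap (symm hza) haw hcu
  have hbc : A.R 4 b c := by
    refine rel_four_of_common_four hA hbu hcu hbp4 hcp4 ?_
    rintro rfl
    exact no3 hbp (symm hzb) (symm hwc) hbu
  exact not_four_clique hA (symm hap4) (symm hbp4) (symm hcp4) hab hac hbc
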